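/- Let $\mathcal X,\mathcal Y$ be Polish spaces. For a Polish space $\mathcal S$ let $\mathcal P(\mathcal S)$ denote the space of Borel probability measures on $\mathcal S$ with the topology of weak convergence, and for $\nu,\mu\in\mathcal P(\mathcal S)$ let $R(\nu\|\mu)=\int\log\frac{d\nu}{d\mu}\,d\nu$ if $\nu\ll\mu$ and $R(\nu\|\mu)=\infty$ otherwise. Let $\mathbb N=\{1,2,\dots\}$. For each $N\in\mathbb N$ let $X^N_1,\dots,X^N_N$ be $\mathcal X$-valued random variables on a probability space $(\Omega_N,\mathcal F_N,\mathbf P_N)$, with empirical measure $\mu^N=\frac1N\sum_{i=1}^N\delta_{X^N_i}$. Let $\gamma_0\in\mathcal P(\mathcal Y)$ and let $\psi:\mathcal P(\mathcal X)\times\mathcal Y\to\mathcal X$ be Borel measurable. Suppose that for each $N$ there are independent $\mathcal Y$-valued random variables $Y^N_1,\dots,Y^N_N$ on $(\Omega_N,\mathcal F_N,\mathbf P_N)$ with common law $\gamma_0$ such that, for every $i\in\{1,\dots,N\}$, $$X^N_i=\psi(\mu^N,Y^N_i)\qquad \mathbf P_N\text{-almost surely.}$$ For $\gamma\in\mathcal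 P(\mathcal Y)$ and $\mu\in\mathcal P(\mathcal X)$ let $\Psi_\gamma(\mu)\in\mathcal P(\mathcal X)$ be the image measure of $\gamma$ under $y\mapsto\psi(\mu,y)$. Let $\mathcal D\subset\mathcal P(\mathcal Y)$ be a Borel set such that: (A1) for every $\gamma\in\mathcal D$ the equation $\mu=\Psi_\gamma(\mu)$ has a unique solution $\mu_*(\gamma)\in\mathcal P(\mathcal X)$, and the map $\mathcal D\ni\gamma\mapsto\mu_*(\gamma)\in\mathcal P(\mathcal X)$ is Borel measurable; (A2) for every $N\in\mathbb N$, $\gamma_0^{\otimes N}\big\{(y_1,\dots,y_N)\in\mathcal Y^N:\frac1N\sum_{i=1}^N\delta_{y_i}\in\mathcal D\big\}=1$; (A3) if $\gamma\in\mathcal P(\mathcal Y)$ satisfies $R(\gamma\|\gamma_0)<\infty$, then $\gamma\in\mathcal D$ and the map $\mu_*:\mathcal D\to\mathcal P(\mathcal X)$ is continuous at $\gamma$. Define $I:\mathcal P(\mathcal X)\to[0,\infty]$ by $$I(\eta)=\inf\{R(\gamma\|\gamma_0):\gamma\in\mathcal D,\ \mu_*(\gamma)=\eta\},\qquad \inf\emptyset=\infty.$$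 Then $I$ is a good rate function, that is, $I$ is lower semicontinuous and its sublevel sets $\{I\le c\}$, $c\in[0,\infty)$, are compact; and $(\mu^N)_{N\in\mathbb N}$ satisfies the large deviation principle with rate function $I$: the $\mu^N$ are $\mathcal P(\mathcal X)$-valued random variables, and for every Borel set $B\subset\mathcal P(\mathcal X)$, $$-\inf_{\eta\in B^\circ}I(\eta)\le\liminf_{N\to\infty}\frac1N\log\mathbf P_N\{\mu^N\in B\}\le\limsup_{N\to\infty}\frac1N\log\mathbf P_N\{\mu^N\in B\}\le-\inf_{\eta\in\operatorname{cl}(B)}I(\eta),$$ where $\log 0=-\infty$, and $B^\circ$ and $\operatorname{cl}(B)$ are the interior and the closure of $B$. -/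

import Mathlib

open MeasureTheory ProbabilityTheory Filter Topology
open scoped ENNReal NNReal

/-- The empirical measure `(1/N) ∑ i, δ_{x i}` of a nonempty finite sample. -/
noncomputable def empiricalMeasure {S : Type*} [MeasurableSpace S] {N : ℕ+}
    (x : Fin N → S) : ProbabilityMeasure S :=
  ⟨((N : ℕ) : ℝ≥0∞)⁻¹ • ∑ i, Measure.dirac (x i), ⟨by
    simp [ENNReal.inv_mul_cancel]⟩⟩

/-- A good rate function: lower semicontinuous, `[0,∞]`-valued, with compact sublevel sets
`{I ≤ c}`, `c ∈ [0,∞)`. -/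
structure IsGoodRateFunction {S : Type*} [TopologicalSpace S] (I : S → ℝ≥0∞) : Prop where
  lowerSemicontinuous : LowerSemicontinuous I
  isCompact_sublevel : ∀ c : ℝ≥0, IsCompact {x | I x ≤ c}

/-- The large deviation principle (with speed `N`) for a sequence `ξ 1, ξ 2, …` of `S`-valued
random variables, each on its own probability space, with rate function `I`.
The logarithm is `[-∞,∞]`-valued with `log 0 = -∞`, and an infimum over the empty set is `∞`. -/
structure SatisfiesLDP {S : Type*} [TopologicalSpace S] {Ω : ℕ+ → Type*}
    [∀ N, MeasurableSpace (Ω N)] (P : ∀ N, Measure (Ω N)) (ξ : ∀ N, Ω N → S)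
    (I : S → ℝ≥0∞) : Prop where
  measurable : ∀ N, Measurable[_, borel S] (ξ N)
  lower_bound : ∀ B : Set S, MeasurableSet[borel S] B →
    -(⨅ x ∈ interior B, (I x : EReal)) ≤
      liminf (fun N : ℕ+ => ((1 / (N : ℝ) : ℝ) : EReal) * ENNReal.log (P N {ω | ξ N ω ∈ B})) atTop
  upper_bound : ∀ B : Set S, MeasurableSet[borel S] B →
    limsup (fun N : ℕ+ => ((1 / (N : ℝ) : ℝ) : EReal) * ENNReal.log (P N {ω | ξ N ω ∈ B})) atTop ≤
      -(⨅ x ∈ closure B, (I x : EReal))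

theorem measurable_section_of_borel {𝒳 𝒴 : Type*}
    [TopologicalSpace 𝒳] [MeasurableSpace 𝒳] [BorelSpace 𝒳]
    [TopologicalSpace 𝒴] [MeasurableSpace 𝒴] [BorelSpace 𝒴]
    {ψ : ProbabilityMeasure 𝒳 × 𝒴 → 𝒳} (hψ : Measurable[borel (ProbabilityMeasure 𝒳 × 𝒴)] ψ)
    (μ : ProbabilityMeasure 𝒳) : Measurable (fun y => ψ (μ, y)) := by
  have h : Measurable[_, borel (ProbabilityMeasure 𝒳 × 𝒴)] (fun y : 𝒴 => (μ, y)) := by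
    rw [BorelSpace.measurable_eq (α := 𝒴)]
    exact (Continuous.prodMk_right μ).borel_measurable
  exact @Measurable.comp _ _ _ _ (borel _) _ _ _ hψ h

/-- `Ψ_γ(μ)`: the image measure of `γ` under `y ↦ ψ(μ, y)`. -/
noncomputable def noiseMap {𝒳 𝒴 : Type*}
    [TopologicalSpace 𝒳] [MeasurableSpace 𝒳] [BorelSpace 𝒳]
    [TopologicalSpace 𝒴] [MeasurableSpace 𝒴] [BorelSpace 𝒴]
    (ψ : ProbabilityMeasure 𝒳 × 𝒴 → 𝒳) (hψ : Measurable[borel (ProbabilityMeasure 𝒳 × 𝒴)] ψ)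
    (γ : ProbabilityMeasure 𝒴) (μ : ProbabilityMeasure 𝒳) : ProbabilityMeasure 𝒳 :=
  γ.map (measurable_section_of_borel hψ μ).aemeasurable

/-- Relative entropy `R(ν‖μ) = ∫ log (dν/dμ) dν` if `ν ≪ μ`, and `∞` otherwise. For probability
measures the negative part of `log (dν/dμ)` is always `ν`-integrable, so the integral is `∞` as
soon as `log (dν/dμ)` is not `ν`-integrable; this is Mathlib's Kullback–Leibler divergence. -/
noncomputable def relEntropy {S : Type*} [MeasurableSpace S] (ν μ : ProbabilityMeasure S) : ℝ≥0∞ :=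
  InformationTheory.klDiv (ν : Measure S) (μ : Measure S)

/-- `I(η) = inf {R(γ‖γ₀) : γ ∈ D, μ_*(γ) = η}`, with `inf ∅ = ∞`. -/
noncomputable def noiseRate {𝒳 𝒴 : Type*} [MeasurableSpace 𝒳] [MeasurableSpace 𝒴]
    (γ₀ : ProbabilityMeasure 𝒴) (D : Set (ProbabilityMeasure 𝒴)) (μstar : D → ProbabilityMeasure 𝒳)
    (η : ProbabilityMeasure 𝒳) : ℝ≥0∞ :=
  ⨅ (γ : D) (_ : μstar γ = η), relEntropy (γ : ProbabilityMeasure 𝒴) γ₀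

/-!
Almost surely the empirical measure `γ^N` of the noise lies in `D`, and the empirical measure `μ^N`
of the particles is a fixed point of `noiseMap ψ hψ γ^N`. By uniqueness `μ^N = μstar γ^N`, so the
large deviation principle for `μ^N` is the image under `μstar` of Sanov's theorem for `γ^N`.

Sanov's theorem is proved here for the weak topology on a Polish space. Its upper bound
(`exists_pi_empiricalMeasure_mem_le`) combines Chernoff's inequality for bounded continuous
functions with exponential tightness and the Donsker–Varadhan formula `relEntropy_le_iff`. Its lower bound
(`eventually_le_pi_empiricalMeasure_mem`) is a change of measure together with the weak law of large
numbers. The compactness of entropy sublevel sets, `isCompact_relEntropy_le`, comes from the same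
variational formula and Prokhorov's theorem.

The contraction principle (`satisfiesLDP_of_ae_eq_contraction`, `isGoodRateFunction_noiseRate`) then
needs `μstar` to be continuous only at measures of finite relative entropy. In the upper bound,
a measure of finite entropy in the closure of `μstar ⁻¹' closure B` is mapped into `closure B`, and
the other measures in that closure contribute nothing; in the lower bound only neighbourhoods of
measures of finite entropy are used.
-/

/-! ### Donsker–Varadhan variational formula -/

open InformationTheory in
theorem mul_le_klFun_add_exp_sub_one {x : ℝ} (hx : 0 ≤ x) (a : ℝ) :
    x * a ≤ klFun x + Real.exp a - 1 := by
  rcases hx.eq_or_lt with rfl | hx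
  · simpa [klFun_zero] using (Real.exp_pos a).le
  · have h : Real.exp a = x * Real.exp (a - Real.log x) := by
      rw [Real.exp_sub, Real.exp_log hx]; field_simp
    have := mul_le_mul_of_nonneg_left (Real.add_one_le_exp (a - Real.log x)) hx.le
    rw [klFun_apply, h]
    linarith

theorem integrable_of_abs_le {S : Type*} [MeasurableSpace S] {μ : Measure S} [IsFiniteMeasure μ]
    {f : S → ℝ} (hf : Measurable f) {M : ℝ} (hM : ∀ x, |f x| ≤ M) : Integrable f μ :=
  .of_bound hf.aestronglyMeasurable M (.of_forall hM)

theorem integrable_exp_of_abs_le {S : Type*} [MeasurableSpace S] {μ : Measure S}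
    [IsFiniteMeasure μ] {f : S → ℝ} (hf : Measurable f) {M : ℝ} (hM : ∀ x, |f x| ≤ M) :
    Integrable (fun x => Real.exp (f x)) μ :=
  integrable_of_abs_le hf.exp (M := Real.exp M) fun x => by
    rw [Real.abs_exp]; exact Real.exp_le_exp.2 (le_of_abs_le (hM x))

theorem integral_exp_pos_of_abs_le {S : Type*} [MeasurableSpace S] {μ : Measure S}
    [IsProbabilityMeasure μ] {f : S → ℝ} (hf : Measurable f) {M : ℝ} (hM : ∀ x, |f x| ≤ M) :
    0 < ∫ x, Real.exp (f x) ∂μ :=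
  integral_exp_pos (integrable_exp_of_abs_le hf hM)

/-- The entropy inequality, the easy half of the Donsker–Varadhan formula: it is Young's inequality
for the conjugate pair `klFun` and `exp · - 1`, integrated against the reference measure. -/
theorem integral_le_klDiv_add_log_integral_exp {S : Type*} [MeasurableSpace S] {ν μ : Measure S}
    [IsProbabilityMeasure ν] [IsProbabilityMeasure μ] (hfin : InformationTheory.klDiv ν μ ≠ ∞)
    {f : S → ℝ} (hf : Measurable f) {M : ℝ} (hM : ∀ x, |f x| ≤ M) :
    ∫ x, f x ∂ν ≤ (InformationTheory.klDiv ν μ).toReal + Real.log (∫ x, Real.exp (f x) ∂μ) := by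
  obtain ⟨hac, hint⟩ := InformationTheory.klDiv_ne_top_iff.1 hfin
  set A := ∫ x, Real.exp (f x) ∂μ with hA
  have hApos : 0 < A := integral_exp_pos_of_abs_le hf hM
  have hfν : Integrable f ν := integrable_of_abs_le hf hM
  have hg : Integrable (fun x => f x - Real.log A) ν := hfν.sub (integrable_const _)
  -- the optimal additive normalisation of `f` makes the integral of `exp` equal to `1`
  have hexp : ∫ x, Real.exp (f x - Real.log A) ∂μ = 1 := by
    simp_rw [Real.exp_sub, Real.exp_log hApos]
    rw [integral_div, ← hA, div_self hApos.ne']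
  have hexpint : Integrable (fun x => Real.exp (f x - Real.log A)) μ := by
    simp_rw [Real.exp_sub]
    exact (integrable_exp_of_abs_le hf hM).div_const _
  have hkl := (InformationTheory.integrable_klFun_rnDeriv_iff hac).2 hint
  have h1 : ∫ x, (f x - Real.log A) ∂ν = ∫ x, (ν.rnDeriv μ x).toReal * (f x - Real.log A) ∂μ := by
    rw [← integral_rnDeriv_smul hac]; rfl
  have h2 : ∫ x, (ν.rnDeriv μ x).toReal * (f x - Real.log A) ∂μ ≤
      ∫ x, (InformationTheory.klFun (ν.rnDeriv μ x).toReal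
        + Real.exp (f x - Real.log A) - 1) ∂μ := by
    refine integral_mono ?_ ((hkl.add hexpint).sub (integrable_const _))
      fun x => mul_le_klFun_add_exp_sub_one ENNReal.toReal_nonneg _
    exact (integrable_rnDeriv_smul_iff hac).2 hg
  have h3 : ∫ x, (InformationTheory.klFun (ν.rnDeriv μ x).toReal
      + Real.exp (f x - Real.log A) - 1) ∂μ = (InformationTheory.klDiv ν μ).toReal := by
    rw [InformationTheory.toReal_klDiv_eq_integral_klFun hac,
      integral_sub (f := fun x => InformationTheory.klFun (ν.rnDeriv μ x).toReal
        + Real.exp (f x - Real.log A)) (hkl.add hexpint) (integrable_const _),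
      integral_add hkl hexpint, hexp]
    simp
  rw [h3, ← h1, integral_sub hfν (integrable_const _)] at h2
  simp only [integral_const, probReal_univ, smul_eq_mul, one_mul] at h2
  linarith

/-- A bound on the Donsker–Varadhan functional over bounded continuous functions extends to bounded
measurable ones, because the former are dense in `L¹(ν + μ)`. -/
theorem integral_le_add_log_integral_exp_of_forall_boundedContinuous {S : Type*}
    [TopologicalSpace S] [PolishSpace S] [MeasurableSpace S] [BorelSpace S] {ν μ : Measure S}
    [IsProbabilityMeasure ν] [IsProbabilityMeasure μ] {c : ℝ}
    (hJ : ∀ f : BoundedContinuousFunction S ℝ,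
      ∫ x, f x ∂ν ≤ c + Real.log (∫ x, Real.exp (f x) ∂μ))
    {f : S → ℝ} (hf : Measurable f) {M : ℝ} (hM : ∀ x, |f x| ≤ M) :
    ∫ x, f x ∂ν ≤ c + Real.log (∫ x, Real.exp (f x) ∂μ) := by
  let _ := TopologicalSpace.upgradeIsCompletelyMetrizable S
  have hM0 : 0 ≤ M := by
    obtain ⟨x⟩ := nonempty_of_isProbabilityMeasure ν
    exact (abs_nonneg _).trans (hM x)
  set A := ∫ x, Real.exp (f x) ∂μ with hA
  have hApos : 0 < A := integral_exp_pos_of_abs_le hf hM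
  have key : ∀ ε > 0, ∫ x, f x ∂ν ≤ ε + (c + Real.log (A + Real.exp M * ε)) := by
    intro ε hε
    obtain ⟨g, hg, -⟩ := (integrable_of_abs_le (μ := ν + μ) hf
      hM).exists_boundedContinuous_integral_sub_le hε
    have hclip : ∀ y : ℝ, |max (-M) (min M y)| ≤ M := fun y => abs_le.2
      ⟨le_max_left _ _, max_le (by linarith) (min_le_left _ _)⟩
    let k : BoundedContinuousFunction S ℝ := .ofNormedAddCommGroup
      (fun x => max (-M) (min M (g x))) (by fun_prop) M fun x => hclip (g x)
    have hkM : ∀ x, |k x| ≤ M := fun x => hclip (g x)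
    have hkm : Measurable k := k.continuous.measurable
    have hfk : ∀ x, |f x - k x| ≤ |f x - g x| := fun x => by
      have h := abs_le.1 (hM x)
      have e : f x = max (-M) (min M (f x)) := by rw [min_eq_right h.2, max_eq_right h.1]
      calc |f x - k x| = |max (-M) (min M (f x)) - max (-M) (min M (g x))| := by rw [← e]; rfl
        _ ≤ |min M (f x) - min M (g x)| := by
          simpa using abs_max_sub_max_le_max (-M) (min M (f x)) (-M) (min M (g x))
        _ ≤ |f x - g x| := by simpa using abs_min_sub_min_le_max M (f x) M (g x)
    have hint : ∀ (ρ : Measure S) [IsFiniteMeasure ρ], Integrable (fun x => |f x - k x|) ρ :=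
      fun ρ _ => ((integrable_of_abs_le hf hM).sub (integrable_of_abs_le hkm hkM)).abs
    have hint' : ∀ (ρ : Measure S) [IsFiniteMeasure ρ], Integrable (fun x => |f x - g x|) ρ :=
      fun ρ _ => ((integrable_of_abs_le hf hM).sub (g.integrable ρ)).abs
    have hsum : ∫ x, |f x - k x| ∂ν + ∫ x, |f x - k x| ∂μ ≤ ε := by
      rw [← integral_add_measure (hint ν) (hint μ)]
      exact (integral_mono (hint _) (hint' _) hfk).trans hg
    have h0ν : 0 ≤ ∫ x, |f x - k x| ∂ν := integral_nonneg fun _ => abs_nonneg _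
    have h0μ : 0 ≤ ∫ x, |f x - k x| ∂μ := integral_nonneg fun _ => abs_nonneg _
    have h1 : ∫ x, f x ∂ν ≤ ∫ x, k x ∂ν + ε := by
      have : ∫ x, f x ∂ν - ∫ x, k x ∂ν ≤ ∫ x, |f x - k x| ∂ν := by
        rw [← integral_sub (integrable_of_abs_le hf hM) (integrable_of_abs_le hkm hkM)]
        exact integral_mono ((integrable_of_abs_le hf hM).sub (integrable_of_abs_le hkm hkM))
          (hint ν) fun x => le_abs_self _
      linarith
    have hlip : ∀ x, Real.exp (k x) ≤ Real.exp (f x) + Real.exp M * |f x - k x| := fun x => by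
      -- `exp` lies above its tangent at `k x`, whose slope is at most `exp M`
      have e1 : Real.exp (k x) * (1 + (f x - k x)) ≤ Real.exp (f x) := by
        have := mul_le_mul_of_nonneg_left (Real.add_one_le_exp (f x - k x))
          (Real.exp_pos (k x)).le
        rwa [← Real.exp_add, add_sub_cancel, add_comm (f x - k x) 1] at this
      have e2 : Real.exp (k x) * -(f x - k x) ≤ Real.exp M * |f x - k x| :=
        (mul_le_mul_of_nonneg_left (neg_le_abs _) (Real.exp_pos _).le).trans
          (mul_le_mul_of_nonneg_right (Real.exp_le_exp.2 (le_of_abs_le (hkM x))) (abs_nonneg _))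
      nlinarith
    have h2 : ∫ x, Real.exp (k x) ∂μ ≤ A + Real.exp M * ε := by
      calc ∫ x, Real.exp (k x) ∂μ
          ≤ ∫ x, (Real.exp (f x) + Real.exp M * |f x - k x|) ∂μ :=
            integral_mono (integrable_exp_of_abs_le hkm hkM)
              ((integrable_exp_of_abs_le hf hM).add ((hint μ).const_mul _)) hlip
        _ = A + Real.exp M * ∫ x, |f x - k x| ∂μ := by
            rw [integral_add (integrable_exp_of_abs_le hf hM) ((hint μ).const_mul _),
              integral_const_mul]
        _ ≤ _ := by
          have := Real.exp_pos M
          gcongr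
          linarith
    have h3 := Real.log_le_log (integral_exp_pos_of_abs_le (μ := μ) hkm hkM) h2
    linarith [hJ k]
  have hcont : ContinuousAt (fun ε : ℝ => ε + (c + Real.log (A + Real.exp M * ε))) 0 := by
    have : A + Real.exp M * 0 ≠ 0 := by simpa using hApos.ne'
    fun_prop (disch := assumption)
  have hlim := hcont.tendsto.mono_left (nhdsWithin_le_nhds (s := Set.Ioi 0))
  simp only [mul_zero, add_zero, zero_add] at hlim
  exact ge_of_tendsto hlim (by filter_upwards [self_mem_nhdsWithin] with ε hε using key ε hε)

/-- Truncating the logarithm at levels `±n` keeps the integrand of the relative entropy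
nonnegative. -/
theorem mul_log_clamp_nonneg {x : ℝ} (hx : 0 ≤ x) {n : ℝ} (hn : 1 ≤ n) :
    0 ≤ x * Real.log (max (Real.exp (-n)) (min (Real.exp n) x)) + 1 - x := by
  have hle : Real.exp (-n) ≤ Real.exp n := Real.exp_le_exp.2 (by linarith)
  rcases le_total x (Real.exp (-n)) with h | h
  · rw [min_eq_right (h.trans hle), max_eq_left h, Real.log_exp]
    have h1 : Real.exp (-n) * (n + 1) ≤ 1 := by
      rw [Real.exp_neg, inv_mul_le_iff₀ (Real.exp_pos n), mul_one]
      exact Real.add_one_le_exp n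
    nlinarith
  rcases le_total x (Real.exp n) with h' | h'
  · rw [min_eq_right h', max_eq_right h]
    exact InformationTheory.klFun_nonneg hx
  · rw [min_eq_left h', max_eq_right hle, Real.log_exp]
    nlinarith

theorem abs_log_clamp_le {n : ℝ} (hn : 0 ≤ n) (x : ℝ) :
    |Real.log (max (Real.exp (-n)) (min (Real.exp n) x))| ≤ n := by
  have hpos : 0 < max (Real.exp (-n)) (min (Real.exp n) x) :=
    (Real.exp_pos _).trans_le (le_max_left _ _)
  rw [abs_le]
  constructor
  · exact (Real.le_log_iff_exp_le hpos).2 (le_max_left _ _)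
  · exact (Real.log_le_iff_le_exp hpos).2
      (max_le (Real.exp_le_exp.2 (by linarith)) (min_le_left _ _))

/-- The hard half of the Donsker–Varadhan formula. Testing against large multiples of indicators of
`μ`-null sets gives absolute continuity; testing against truncations of `log (dν/dμ)` and Fatou's
lemma give the bound. -/
theorem klDiv_le_of_forall_boundedContinuous {S : Type*}
    [TopologicalSpace S] [PolishSpace S] [MeasurableSpace S] [BorelSpace S] {ν μ : Measure S}
    [IsProbabilityMeasure ν] [IsProbabilityMeasure μ] {c : ℝ}
    (hJ : ∀ f : BoundedContinuousFunction S ℝ,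
      ∫ x, f x ∂ν ≤ c + Real.log (∫ x, Real.exp (f x) ∂μ)) :
    InformationTheory.klDiv ν μ ≤ ENNReal.ofReal c := by
  have hJ' : ∀ (f : S → ℝ), Measurable f → ∀ M, (∀ x, |f x| ≤ M) → _ := fun f hf M hM =>
    integral_le_add_log_integral_exp_of_forall_boundedContinuous hJ hf hM
  have hac : ν ≪ μ := by
    refine Measure.AbsolutelyContinuous.mk fun s hs hμs => ?_
    by_contra hν
    have hpos : 0 < ν.real s := ENNReal.toReal_pos hν (measure_ne_top _ _)
    set t : ℝ := (|c| + 1) / ν.real s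
    have h := hJ' (s.indicator fun _ => t) (measurable_const.indicator hs) |t| fun x => by
      by_cases hx : x ∈ s <;> simp [hx]
    have hexp : ∫ x, Real.exp (s.indicator (fun _ => t) x) ∂μ = 1 := by
      have : (fun x => Real.exp (s.indicator (fun _ => t) x)) =ᵐ[μ] fun _ => 1 := by
        filter_upwards [measure_eq_zero_iff_ae_notMem.1 hμs] with x hx
        simp [hx]
      simp [integral_congr_ae this]
    rw [hexp, integral_indicator_const _ hs, Real.log_one, smul_eq_mul, mul_div_cancel₀ _ hpos.ne']
      at h
    linarith [le_abs_self c]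
  set h : S → ℝ := fun x => (ν.rnDeriv μ x).toReal with hh
  have hm : Measurable h := (Measure.measurable_rnDeriv ν μ).ennreal_toReal
  have h0 : ∀ x, 0 ≤ h x := fun x => ENNReal.toReal_nonneg
  have hint : Integrable h μ := Measure.integrable_toReal_rnDeriv
  have hint1 : ∫ x, h x ∂μ = 1 := by simp [hh, Measure.integral_toReal_rnDeriv hac]
  let q : ℕ → S → ℝ := fun n x => Real.log (max (Real.exp (-(n : ℝ))) (min (Real.exp n) (h x)))
  have hqm : ∀ n, Measurable (q n) := fun n => by fun_prop
  have hqb : ∀ n x, |q n x| ≤ n := fun n x => abs_log_clamp_le n.cast_nonneg _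
  have hexp : ∀ n, ∫ x, Real.exp (q n x) ∂μ ≤ 1 + Real.exp (-(n : ℝ)) := fun n => by
    calc ∫ x, Real.exp (q n x) ∂μ ≤ ∫ x, (h x + Real.exp (-(n : ℝ))) ∂μ := by
          refine integral_mono (integrable_exp_of_abs_le (hqm n) (hqb n))
            (hint.add (integrable_const _)) fun x => ?_
          have : Real.exp (q n x) = max (Real.exp (-(n : ℝ))) (min (Real.exp n) (h x)) :=
            Real.exp_log ((Real.exp_pos _).trans_le (le_max_left _ _))
          simp only [this]
          exact max_le (by linarith [h0 x]) ((min_le_right _ _).trans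
            (by linarith [Real.exp_pos (-(n : ℝ))]))
      _ = _ := by rw [integral_add hint (integrable_const _), hint1]; simp
  have hbound : ∀ n : ℕ, 1 ≤ n →
      ∫⁻ x, ENNReal.ofReal (h x * q n x + 1 - h x) ∂μ ≤
        ENNReal.ofReal (c + Real.exp (-(n : ℝ))) := by
    intro n hn
    have hn' : (1 : ℝ) ≤ n := by exact_mod_cast hn
    have hqi : Integrable (fun x => h x * q n x) μ :=
      (integrable_rnDeriv_smul_iff hac).2 (integrable_of_abs_le (hqm n) (hqb n))
    have hsi : Integrable (fun x => h x * q n x + 1) μ := hqi.add (integrable_const _)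
    rw [← ofReal_integral_eq_lintegral_ofReal (f := fun x => h x * q n x + 1 - h x)
      (hsi.sub hint) (.of_forall fun x => mul_log_clamp_nonneg (h0 x) hn')]
    refine ENNReal.ofReal_le_ofReal ?_
    rw [integral_sub hsi hint, integral_add hqi (integrable_const _),
      hint1]
    have e : ∫ x, h x * q n x ∂μ = ∫ x, q n x ∂ν := by rw [← integral_rnDeriv_smul hac]; rfl
    have h1 := hJ' (q n) (hqm n) n (hqb n)
    have h2 : Real.log (∫ x, Real.exp (q n x) ∂μ) ≤ Real.exp (-(n : ℝ)) := by
      have hp := integral_exp_pos_of_abs_le (μ := μ) (hqm n) (hqb n)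
      linarith [Real.log_le_sub_one_of_pos hp, hexp n]
    simp only [integral_const, probReal_univ, smul_eq_mul, mul_one]
    linarith
  have hlim : ∀ x, Tendsto (fun n : ℕ => ENNReal.ofReal (h x * q n x + 1 - h x)) atTop
      (𝓝 (ENNReal.ofReal (InformationTheory.klFun (h x)))) := by
    intro x
    refine (ENNReal.continuous_ofReal.tendsto _).comp ?_
    rw [InformationTheory.klFun_apply]
    rcases (h0 x).eq_or_lt with hx | hx
    · simp [← hx]
    -- for a positive density the truncation is eventually inactive
    refine tendsto_const_nhds.congr' ?_
    have e1 : ∀ᶠ n : ℕ in atTop, Real.exp (-(n : ℝ)) ≤ h x := by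
      have := Real.tendsto_exp_neg_atTop_nhds_zero.comp tendsto_natCast_atTop_atTop
      exact (this.eventually (gt_mem_nhds hx)).mono fun n hn => le_of_lt hn
    have e2 : ∀ᶠ n : ℕ in atTop, h x ≤ Real.exp n :=
      (Real.tendsto_exp_atTop.comp tendsto_natCast_atTop_atTop).eventually_ge_atTop (h x)
    filter_upwards [e1, e2] with n h1 h2
    simp only [q]
    rw [min_eq_right h2, max_eq_right h1]
  rw [InformationTheory.klDiv_eq_lintegral_klFun_of_ac hac]
  calc ∫⁻ x, ENNReal.ofReal (InformationTheory.klFun (h x)) ∂μ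
      = ∫⁻ x, liminf (fun n : ℕ => ENNReal.ofReal (h x * q n x + 1 - h x)) atTop ∂μ :=
        lintegral_congr fun x => (hlim x).liminf_eq.symm
    _ ≤ liminf (fun n : ℕ => ∫⁻ x, ENNReal.ofReal (h x * q n x + 1 - h x) ∂μ) atTop :=
        lintegral_liminf_le fun n => by fun_prop
    _ ≤ liminf (fun n : ℕ => ENNReal.ofReal (c + Real.exp (-(n : ℝ)))) atTop :=
        liminf_le_liminf ((eventually_ge_atTop 1).mono hbound)
    _ = ENNReal.ofReal c := by
        refine Tendsto.liminf_eq ((ENNReal.continuous_ofReal.tendsto _).comp ?_)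
        simpa using (Real.tendsto_exp_neg_atTop_nhds_zero.comp
          tendsto_natCast_atTop_atTop).const_add c

/-! ### Empirical measures and finite product measures -/

theorem coe_empiricalMeasure {S : Type*} [MeasurableSpace S] {N : ℕ+} (x : Fin N → S) :
    (empiricalMeasure x : Measure S) = ((N : ℕ) : ℝ≥0∞)⁻¹ • ∑ i, Measure.dirac (x i) := rfl

theorem integral_empiricalMeasure {S : Type*} [MeasurableSpace S] {N : ℕ+} (x : Fin N → S)
    {f : S → ℝ} (hf : Measurable f) :
    ∫ s, f s ∂(empiricalMeasure x : Measure S) = (N : ℝ)⁻¹ * ∑ i, f (x i) := by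
  rw [coe_empiricalMeasure, integral_smul_measure, integral_finsetSum_measure]
  · simp [integral_dirac' _ _ hf.stronglyMeasurable]
  · exact fun i _ => integrable_dirac' hf.stronglyMeasurable (by simp)

theorem continuous_empiricalMeasure {S : Type*} [TopologicalSpace S] [MeasurableSpace S]
    [OpensMeasurableSpace S] (N : ℕ+) :
    Continuous (empiricalMeasure : (Fin N → S) → ProbabilityMeasure S) := by
  refine ProbabilityMeasure.continuous_iff_forall_continuous_integral.2 fun f => ?_
  simp_rw [integral_empiricalMeasure _ f.continuous.measurable]
  fun_prop

theorem lintegral_prod_pi {S : Type*} [MeasurableSpace S] (μ : Measure S) [IsProbabilityMeasure μ]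
    {n : ℕ} {w : Fin n → S → ℝ≥0∞} (hw : ∀ i, Measurable (w i)) :
    ∫⁻ y, ∏ i, w i (y i) ∂Measure.pi (fun _ : Fin n => μ) = ∏ i, ∫⁻ s, w i s ∂μ := by
  rw [lintegral_prod_eq_prod_lintegral_of_indepFun Finset.univ (fun i (y : Fin n → S) => w i (y i))
    (iIndepFun_pi (X := w) fun i => (hw i).aemeasurable)
    fun i => (hw i).comp (measurable_pi_apply i)]
  refine Finset.prod_congr rfl fun i _ => ?_
  rw [← (measurePreserving_eval (fun _ : Fin n => μ) i).lintegral_comp (hw i)]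

/-- Markov's inequality for a product of independent copies of a nonnegative function. -/
theorem pi_le_prod_le_pow_div {S : Type*} [MeasurableSpace S] (μ : Measure S)
    [IsProbabilityMeasure μ] {n : ℕ} {w : S → ℝ≥0∞} (hw : Measurable w) {t : ℝ≥0∞} (ht : t ≠ 0)
    (ht' : t ≠ ∞) :
    Measure.pi (fun _ : Fin n => μ) {y | t ≤ ∏ i, w (y i)} ≤ (∫⁻ s, w s ∂μ) ^ n / t := by
  refine (meas_ge_le_lintegral_div ?_ ht ht').trans_eq ?_
  · exact (Finset.measurable_prod _ fun i _ => hw.comp (measurable_pi_apply i)).aemeasurable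
  · rw [lintegral_prod_pi μ fun _ => hw]; simp

theorem pi_withDensity_eq {S : Type*} [MeasurableSpace S] (μ : Measure S) [IsProbabilityMeasure μ]
    {h : S → ℝ≥0∞} (hh : Measurable h) [IsProbabilityMeasure (μ.withDensity h)] (n : ℕ) :
    Measure.pi (fun _ : Fin n => μ.withDensity h) =
      (Measure.pi fun _ : Fin n => μ).withDensity fun y => ∏ i, h (y i) := by
  refine Measure.pi_eq fun s hs => ?_
  rw [withDensity_apply _ (.univ_pi hs), ← lintegral_indicator (.univ_pi hs)]
  have : ∀ y : Fin n → S, (Set.univ.pi s).indicator (fun y => ∏ i, h (y i)) y =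
      ∏ i, (s i).indicator h (y i) := fun y => by
    by_cases hy : y ∈ Set.univ.pi s
    · rw [Set.indicator_of_mem hy]
      exact Finset.prod_congr rfl fun i _ => (Set.indicator_of_mem (hy i trivial) _).symm
    · rw [Set.indicator_of_notMem hy]
      obtain ⟨i, hi⟩ : ∃ i, y i ∉ s i := by simpa [Set.mem_pi] using hy
      exact (Finset.prod_eq_zero (Finset.mem_univ i) (Set.indicator_of_notMem hi _)).symm
  simp_rw [this]
  rw [lintegral_prod_pi μ fun i => hh.indicator (hs i)]
  exact Finset.prod_congr rfl fun i _ => by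
    rw [lintegral_indicator (hs i), withDensity_apply _ (hs i)]

/-- The weak law of large numbers for the coordinates of finite product measures, obtained from the
strong law on the infinite product. -/
theorem tendsto_pi_le_abs_average_sub_integral {S : Type*} [MeasurableSpace S] (ν : Measure S)
    [IsProbabilityMeasure ν] {g : S → ℝ} (hg : Measurable g) (hgi : Integrable g ν) {ε : ℝ}
    (hε : 0 < ε) :
    Tendsto (fun N : ℕ+ => Measure.pi (fun _ : Fin N => ν)
      {y | ε ≤ |(N : ℝ)⁻¹ * ∑ i, g (y i) - ∫ s, g s ∂ν|}) atTop (𝓝 0) := by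
  set P : Measure (ℕ → S) := Measure.infinitePi fun _ => ν
  have hcoord : iIndepFun (fun (i : ℕ) (ω : ℕ → S) => ω i) P :=
    iIndepFun_infinitePi (P := fun _ => ν) (X := fun _ s => s) fun _ => measurable_id
  have hmap : ∀ i : ℕ, P.map (fun ω => ω i) = ν := fun i =>
    Measure.infinitePi_map_eval (fun _ : ℕ => ν) i
  have hident : ∀ i : ℕ, IdentDistrib (fun ω : ℕ → S => g (ω i)) (fun ω => g (ω 0)) P P := by
    intro i
    refine IdentDistrib.comp (u := g) ⟨(measurable_pi_apply i).aemeasurable,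
      (measurable_pi_apply 0).aemeasurable, ?_⟩ hg
    exact (hmap i).trans (hmap 0).symm
  have hexp : ∫ ω, g (ω 0) ∂P = ∫ s, g s ∂ν := by
    rw [← hmap 0, integral_map (measurable_pi_apply 0).aemeasurable hg.aestronglyMeasurable]
  have hslln := strong_law_ae (μ := P) (fun n ω => g (ω n))
    (by
      have : Integrable g (P.map fun ω => ω 0) := by rwa [hmap 0]
      exact this.comp_measurable (measurable_pi_apply 0))
    (fun i j hij => (hcoord.indepFun hij).comp hg hg) hident
  rw [hexp] at hslln
  have hmeas : TendstoInMeasure P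
      (fun (n : ℕ) ω => (n : ℝ)⁻¹ • ∑ i ∈ Finset.range n, g (ω i)) atTop
      (fun _ => ∫ s, g s ∂ν) := by
    refine tendstoInMeasure_of_tendsto_ae (fun n => ?_) hslln
    exact Measurable.aestronglyMeasurable (by fun_prop)
  rw [tendstoInMeasure_iff_norm] at hmeas
  refine ((hmeas ε hε).comp tendsto_PNat_val_atTop_atTop).congr fun N => ?_
  have hpi : P.map (fun ω (i : Fin N) => ω i) = Measure.pi fun _ : Fin N => ν := by
    have := (hcoord.precomp (Fin.val_injective (n := N))).map_fun_eq_pi_map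
      fun i => (measurable_pi_apply _).aemeasurable
    simpa [hmap] using this
  rw [← hpi, Measure.map_apply (by fun_prop)]
  · simp [Finset.sum_range]
  · exact measurableSet_le (by fun_prop) (by fun_prop)

/-! ### Chernoff bounds -/

theorem ofReal_exp_sum {n : ℕ} (f : Fin n → ℝ) :
    ∏ i, ENNReal.ofReal (Real.exp (f i)) = ENNReal.ofReal (Real.exp (∑ i, f i)) := by
  rw [Real.exp_sum, ENNReal.ofReal_prod_of_nonneg fun i _ => (Real.exp_pos _).le]

theorem sum_eq_mul_integral_empiricalMeasure {S : Type*} [MeasurableSpace S] {N : ℕ+}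
    (x : Fin N → S) {f : S → ℝ} (hf : Measurable f) :
    ∑ i, f (x i) = N * ∫ s, f s ∂(empiricalMeasure x : Measure S) := by
  rw [integral_empiricalMeasure x hf, mul_inv_cancel_left₀]
  exact_mod_cast N.ne_zero

/-- Chernoff's bound for the empirical measure. -/
theorem pi_le_integral_empiricalMeasure_le {S : Type*} [MeasurableSpace S] (μ : Measure S)
    [IsProbabilityMeasure μ] {f : S → ℝ} (hf : Measurable f) {M : ℝ} (hM : ∀ x, |f x| ≤ M)
    (a : ℝ) (N : ℕ+) :
    Measure.pi (fun _ : Fin N => μ)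
        {y | a + Real.log (∫ x, Real.exp (f x) ∂μ) ≤ ∫ s, f s ∂(empiricalMeasure y : Measure S)} ≤
      ENNReal.ofReal (Real.exp (-(N * a))) := by
  have hpos := integral_exp_pos_of_abs_le (μ := μ) hf hM
  set A := ∫ x, Real.exp (f x) ∂μ with hA
  have hN : (0 : ℝ) < N := by exact_mod_cast N.pos
  have ht : 0 < Real.exp (N * (a + Real.log A)) := Real.exp_pos _
  refine (measure_mono fun y hy => ?_).trans ((pi_le_prod_le_pow_div μ (n := N)
    (w := fun s => ENNReal.ofReal (Real.exp (f s))) (by fun_prop)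
    (t := ENNReal.ofReal (Real.exp (N * (a + Real.log A)))) (by simpa using ht)
    ENNReal.ofReal_ne_top).trans_eq ?_)
  · simp only [Set.mem_ofPred_eq] at hy ⊢
    rw [ofReal_exp_sum fun i => f (y i), sum_eq_mul_integral_empiricalMeasure y hf]
    gcongr
  · rw [← ofReal_integral_eq_lintegral_ofReal (integrable_exp_of_abs_le hf hM)
      (.of_forall fun x => (Real.exp_pos _).le), ← hA, ← ENNReal.ofReal_pow hpos.le,
      ← ENNReal.ofReal_div_of_pos ht]
    congr 1
    have : A ^ (N : ℕ) = Real.exp (N * Real.log A) := by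
      rw [Real.exp_nat_mul, Real.exp_log hpos]
    rw [this, ← Real.exp_sub]
    congr 1
    ring

/-! ### Exponential tightness -/

theorem exists_isCompact_measure_compl_le_inv {S : Type*} [TopologicalSpace S] [PolishSpace S]
    [MeasurableSpace S] [BorelSpace S] (μ : Measure S) [IsProbabilityMeasure μ] :
    ∃ K : ℕ → Set S, (∀ n, IsCompact (K n)) ∧
      ∀ n, μ (K n)ᶜ ≤ ENNReal.ofReal ((n + 1) * 2 ^ (n + 1))⁻¹ := by
  have h := isTightMeasureSet_iff_exists_isCompact_measure_compl_le.1
    (isTightMeasureSet_singleton (μ := μ))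
  choose K hK hμ using fun n : ℕ => h (ENNReal.ofReal (((n : ℝ) + 1) * 2 ^ (n + 1))⁻¹)
    (ENNReal.ofReal_pos.2 (by positivity))
  exact ⟨K, hK, fun n => hμ n μ rfl⟩

/-- The probability measures whose mass outside the compact set `K n` is at most `L / log (n + 2)`
for every `n`. -/
def logTightSet {S : Type*} [MeasurableSpace S] (K : ℕ → Set S) (L : ℝ) :
    Set (ProbabilityMeasure S) :=
  {ν | ∀ n : ℕ, ν (K n)ᶜ ≤ (L / Real.log (n + 2)).toNNReal}

theorem isCompact_logTightSet {S : Type*} [TopologicalSpace S] [PolishSpace S]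
    [MeasurableSpace S] [BorelSpace S] {K : ℕ → Set S} (hK : ∀ n, IsCompact (K n)) (L : ℝ) :
    IsCompact (logTightSet K L) := by
  let _ := TopologicalSpace.upgradeIsCompletelyMetrizable S
  refine isCompact_setOfPred_probabilityMeasure_mass_eq_compl_isCompact_le ?_ hK
    (.inl inferInstance)
  have h1 : Tendsto (fun n : ℕ => Real.log ((n : ℝ) + 2)) atTop atTop :=
    Real.tendsto_log_atTop.comp (tendsto_atTop_add_const_right _ _ tendsto_natCast_atTop_atTop)
  have h2 := (continuous_real_toNNReal.tendsto _).comp (h1.const_div_atTop L)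
  rwa [Real.toNNReal_zero] at h2

/-- Membership in `logTightSet` is tested by the integrals of `log (n + 2)` times the indicator of
the complement of `K n`. -/
theorem mem_logTightSet_of_forall_integral_le {S : Type*} [MeasurableSpace S] {K : ℕ → Set S}
    (hK : ∀ n, MeasurableSet (K n)) {L : ℝ} {ν : ProbabilityMeasure S}
    (h : ∀ n : ℕ, ∫ s, (K n)ᶜ.indicator (fun _ => Real.log (n + 2)) s ∂(ν : Measure S) ≤ L) :
    ν ∈ logTightSet K L := by
  intro n
  have hlog : 0 < Real.log ((n : ℝ) + 2) := Real.log_pos (by linarith [n.cast_nonneg (α := ℝ)])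
  have := h n
  rw [integral_indicator_const _ (hK n).compl, smul_eq_mul, ← le_div_iff₀ hlog] at this
  rw [← Real.toNNReal_coe (r := ν (K n)ᶜ)]
  exact Real.toNNReal_le_toNNReal this

theorem relEntropy_le_imp_mem_logTightSet {S : Type*} [MeasurableSpace S] {K : ℕ → Set S}
    (hK : ∀ n, MeasurableSet (K n)) {μ : ProbabilityMeasure S}
    (hμ : ∀ n : ℕ, (μ : Measure S) (K n)ᶜ ≤ ENNReal.ofReal ((n + 1) * 2 ^ (n + 1))⁻¹)
    {ν : ProbabilityMeasure S} {c : ℝ≥0} (hc : relEntropy ν μ ≤ c) :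
    ν ∈ logTightSet K (c + 1) := by
  refine mem_logTightSet_of_forall_integral_le hK fun n => ?_
  have hlog : 0 < Real.log ((n : ℝ) + 2) := Real.log_pos (by linarith [n.cast_nonneg (α := ℝ)])
  have hfm : Measurable ((K n)ᶜ.indicator fun _ => Real.log ((n : ℝ) + 2)) :=
    measurable_const.indicator (hK n).compl
  have hfb : ∀ x, |(K n)ᶜ.indicator (fun _ => Real.log ((n : ℝ) + 2)) x| ≤ Real.log (n + 2) := by
    intro x
    by_cases hx : x ∈ (K n)ᶜ
    · rw [Set.indicator_of_mem hx, abs_of_pos hlog]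
    · rw [Set.indicator_of_notMem hx, abs_zero]; exact hlog.le
  have h := integral_le_klDiv_add_log_integral_exp (ν := (ν : Measure S)) (μ := (μ : Measure S))
    (ne_top_of_le_ne_top ENNReal.coe_ne_top hc) hfm hfb
  have h1 : (InformationTheory.klDiv (ν : Measure S) (μ : Measure S)).toReal ≤ c :=
    ENNReal.toReal_mono ENNReal.coe_ne_top hc
  have hexp : ∀ x, Real.exp ((K n)ᶜ.indicator (fun _ => Real.log ((n : ℝ) + 2)) x) =
      1 + (K n)ᶜ.indicator (fun _ => (n : ℝ) + 1) x := fun x => by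
    by_cases hx : x ∈ (K n)ᶜ
    · rw [Set.indicator_of_mem hx, Set.indicator_of_mem hx, Real.exp_log (by positivity)]; ring
    · rw [Set.indicator_of_notMem hx, Set.indicator_of_notMem hx]; simp
  have h2 : ∫ x, Real.exp ((K n)ᶜ.indicator (fun _ => Real.log ((n : ℝ) + 2)) x)
      ∂(μ : Measure S) ≤ 2 := by
    simp_rw [hexp]
    rw [integral_add (integrable_const _) ((integrable_const _).indicator (hK n).compl),
      integral_indicator_const _ (hK n).compl]
    have h3 : (μ : Measure S).real (K n)ᶜ ≤ (((n : ℝ) + 1) * 2 ^ (n + 1))⁻¹ :=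
      ENNReal.toReal_le_of_le_ofReal (by positivity) (hμ n)
    have h4 : (((n : ℝ) + 1) * 2 ^ (n + 1))⁻¹ * (n + 1) ≤ 1 := by
      rw [mul_inv, mul_right_comm, inv_mul_cancel₀ (by positivity), one_mul]
      exact inv_le_one_of_one_le₀ (one_le_pow₀ (by norm_num))
    have h5 := mul_le_mul_of_nonneg_right h3 (by positivity : (0 : ℝ) ≤ n + 1)
    simp only [integral_const, probReal_univ, smul_eq_mul, mul_one]
    linarith
  have h3 : Real.log (∫ x, Real.exp ((K n)ᶜ.indicator (fun _ => Real.log ((n : ℝ) + 2)) x)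
      ∂(μ : Measure S)) ≤ 1 := by
    have hp : 0 < ∫ x, Real.exp ((K n)ᶜ.indicator (fun _ => Real.log ((n : ℝ) + 2)) x)
      ∂(μ : Measure S) := integral_exp_pos_of_abs_le hfm hfb
    linarith [Real.log_le_sub_one_of_pos hp]
  linarith

/-- Exponential tightness of the empirical measures. The weight `1 + ∑ (n + 1) 1_{(K n)ᶜ}` has mean
at most `2`, and its product over a sample whose empirical measure is not in `logTightSet K L` is
at least `exp (N * L)`. -/
theorem pi_empiricalMeasure_notMem_logTightSet_le {S : Type*} [MeasurableSpace S] {K : ℕ → Set S}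
    (hK : ∀ n, MeasurableSet (K n)) {μ : Measure S} [IsProbabilityMeasure μ]
    (hμ : ∀ n : ℕ, μ (K n)ᶜ ≤ ENNReal.ofReal ((n + 1) * 2 ^ (n + 1))⁻¹) (a : ℝ) (N : ℕ+) :
    Measure.pi (fun _ : Fin N => μ) {y | empiricalMeasure y ∉ logTightSet K (a + Real.log 2)} ≤
      ENNReal.ofReal (Real.exp (-(N * a))) := by
  let W : S → ℝ≥0∞ := fun s => 1 + ∑' n : ℕ, (K n)ᶜ.indicator (fun _ => ((n : ℝ≥0∞) + 1)) s
  have hWsum : Measurable fun s => ∑' n : ℕ, (K n)ᶜ.indicator (fun _ => ((n : ℝ≥0∞) + 1)) s :=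
    Measurable.tsum fun n => measurable_const.indicator (hK n).compl
  have hWm : Measurable W := measurable_const.add hWsum
  have hW : ∫⁻ s, W s ∂μ ≤ ENNReal.ofReal 2 := by
    have h1 : ∀ n : ℕ, ∫⁻ s, (K n)ᶜ.indicator (fun _ => ((n : ℝ≥0∞) + 1)) s ∂μ ≤
        ENNReal.ofReal (1 / 2 / 2 ^ n) := fun n => by
      rw [lintegral_indicator_const (hK n).compl]
      calc ((n : ℝ≥0∞) + 1) * μ (K n)ᶜ
          ≤ ENNReal.ofReal ((n : ℝ) + 1) * ENNReal.ofReal (((n : ℝ) + 1) * 2 ^ (n + 1))⁻¹ := by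
            refine mul_le_mul' (le_of_eq ?_) (hμ n)
            rw [ENNReal.ofReal_add n.cast_nonneg zero_le_one]; simp
        _ = _ := by
            rw [← ENNReal.ofReal_mul (by positivity)]
            congr 1
            field_simp
            ring
    calc ∫⁻ s, W s ∂μ
        = 1 + ∑' n : ℕ, ∫⁻ s, (K n)ᶜ.indicator (fun _ => ((n : ℝ≥0∞) + 1)) s ∂μ := by
          rw [lintegral_add_left measurable_const, lintegral_tsum fun n =>
            (measurable_const.indicator (hK n).compl).aemeasurable]
          simp
      _ ≤ 1 + ∑' n : ℕ, ENNReal.ofReal (1 / 2 / 2 ^ n) := by gcongr with n; exact h1 n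
      _ = ENNReal.ofReal 2 := by
          rw [← ENNReal.ofReal_tsum_of_nonneg (fun n => by positivity) (summable_geometric_two' 1),
            tsum_geometric_two' 1, ← ENNReal.ofReal_one, ← ENNReal.ofReal_add] <;> norm_num
  have ht : 0 < Real.exp (N * (a + Real.log 2)) := Real.exp_pos _
  refine (measure_mono fun y hy => ?_).trans ((pi_le_prod_le_pow_div μ (n := N) hWm
    (t := ENNReal.ofReal (Real.exp (N * (a + Real.log 2)))) (by simpa using ht)
    ENNReal.ofReal_ne_top).trans ?_)
  · obtain ⟨n, hn⟩ : ∃ n : ℕ, a + Real.log 2 < ∫ s, (K n)ᶜ.indicator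
        (fun _ => Real.log (n + 2)) s ∂(empiricalMeasure y : Measure S) := by
      by_contra! h
      exact hy (mem_logTightSet_of_forall_integral_le hK h)
    have hm : Measurable ((K n)ᶜ.indicator fun _ => Real.log ((n : ℝ) + 2)) :=
      measurable_const.indicator (hK n).compl
    calc ENNReal.ofReal (Real.exp (N * (a + Real.log 2)))
        ≤ ENNReal.ofReal (Real.exp (∑ i, (K n)ᶜ.indicator
            (fun _ => Real.log ((n : ℝ) + 2)) (y i))) := by
          rw [sum_eq_mul_integral_empiricalMeasure y hm]
          gcongr
      _ = ∏ i, ENNReal.ofReal (Real.exp ((K n)ᶜ.indicator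
            (fun _ => Real.log ((n : ℝ) + 2)) (y i))) := (ofReal_exp_sum _).symm
      _ ≤ ∏ i, W (y i) := by
          refine Finset.prod_le_prod' fun i _ => ?_
          by_cases hx : y i ∈ (K n)ᶜ
          · have h1 := ENNReal.le_tsum (f := fun n : ℕ =>
              (K n)ᶜ.indicator (fun _ => ((n : ℝ≥0∞) + 1)) (y i)) n
            simp only [Set.indicator_of_mem hx] at h1
            rw [Set.indicator_of_mem hx, Real.exp_log (by positivity)]
            refine le_trans (le_of_eq ?_) (add_le_add_right h1 1)
            rw [ENNReal.ofReal_add n.cast_nonneg zero_le_two]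
            simp only [ENNReal.ofReal_natCast, ENNReal.ofReal_ofNat]
            ring
          · rw [Set.indicator_of_notMem hx]
            simp [W]
  · calc (∫⁻ s, W s ∂μ) ^ (N : ℕ) / ENNReal.ofReal (Real.exp (N * (a + Real.log 2)))
        ≤ ENNReal.ofReal 2 ^ (N : ℕ) / ENNReal.ofReal (Real.exp (N * (a + Real.log 2))) := by
          gcongr
      _ = _ := by
          rw [← ENNReal.ofReal_pow zero_le_two, ← ENNReal.ofReal_div_of_pos ht]
          congr 1
          have : (2 : ℝ) ^ (N : ℕ) = Real.exp (N * Real.log 2) := by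
            rw [Real.exp_nat_mul, Real.exp_log zero_lt_two]
          rw [this, ← Real.exp_sub]
          congr 1
          ring

/-! ### Sanov's theorem -/

/-- The Donsker–Varadhan variational formula, in sublevel form. -/
theorem relEntropy_le_iff {S : Type*}
    [TopologicalSpace S] [PolishSpace S] [MeasurableSpace S] [BorelSpace S]
    {ν μ : ProbabilityMeasure S} {c : ℝ≥0} :
    relEntropy ν μ ≤ c ↔ ∀ f : BoundedContinuousFunction S ℝ,
      ∫ x, f x ∂(ν : Measure S) ≤ c + Real.log (∫ x, Real.exp (f x) ∂(μ : Measure S)) := by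
  refine ⟨fun h f => ?_, fun h => ?_⟩
  · refine (integral_le_klDiv_add_log_integral_exp (ne_top_of_le_ne_top ENNReal.coe_ne_top h)
      f.continuous.measurable f.norm_coe_le_norm).trans ?_
    gcongr
    exact ENNReal.toReal_mono ENNReal.coe_ne_top h
  · simpa [relEntropy] using klDiv_le_of_forall_boundedContinuous h

theorem continuous_integral_boundedContinuousFunction_probabilityMeasure {S : Type*}
    [TopologicalSpace S] [MeasurableSpace S] [OpensMeasurableSpace S]
    (f : BoundedContinuousFunction S ℝ) :
    Continuous fun ν : ProbabilityMeasure S => ∫ x, f x ∂(ν : Measure S) :=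
  ProbabilityMeasure.continuous_iff_forall_continuous_integral.1 continuous_id f

theorem isCompact_relEntropy_le {S : Type*}
    [TopologicalSpace S] [PolishSpace S] [MeasurableSpace S] [BorelSpace S]
    (μ : ProbabilityMeasure S) (c : ℝ≥0) :
    IsCompact {ν : ProbabilityMeasure S | relEntropy ν μ ≤ c} := by
  obtain ⟨K, hK, hμ⟩ := exists_isCompact_measure_compl_le_inv (μ : Measure S)
  refine (isCompact_logTightSet hK (c + 1)).of_isClosed_subset ?_ fun ν hν =>
    relEntropy_le_imp_mem_logTightSet (fun n => (hK n).measurableSet) hμ hν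
  simp_rw [relEntropy_le_iff, Set.ofPred_forall]
  exact isClosed_iInter fun f => isClosed_le
    (continuous_integral_boundedContinuousFunction_probabilityMeasure f) continuous_const

/-- The upper bound in Sanov's theorem, in non-asymptotic form. No measurability is needed since
outer measures are subadditive: the relevant part of `closure G` is compact by exponential tightness
and is covered by finitely many Chernoff half-spaces. -/
theorem exists_pi_empiricalMeasure_mem_le {S : Type*}
    [TopologicalSpace S] [PolishSpace S] [MeasurableSpace S] [BorelSpace S]
    (μ : ProbabilityMeasure S) {G : Set (ProbabilityMeasure S)} {a : ℝ≥0}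
    (ha : ∀ ν ∈ closure G, a < relEntropy ν μ) :
    ∃ C : ℝ, 0 < C ∧ ∀ N : ℕ+,
      Measure.pi (fun _ : Fin N => (μ : Measure S)) {y | empiricalMeasure y ∈ G} ≤
        ENNReal.ofReal (C * Real.exp (-(N * a))) := by
  obtain ⟨K, hK, hμ⟩ := exists_isCompact_measure_compl_le_inv (μ : Measure S)
  have hcomp := (isCompact_logTightSet hK (a + Real.log 2)).inter_right (isClosed_closure (s := G))
  let U : BoundedContinuousFunction S ℝ → Set (ProbabilityMeasure S) := fun f =>
    {ν | a + Real.log (∫ x, Real.exp (f x) ∂(μ : Measure S)) < ∫ x, f x ∂(ν : Measure S)}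
  obtain ⟨t, ht⟩ := hcomp.elim_finite_subcover U
    (fun f => isOpen_lt continuous_const
      (continuous_integral_boundedContinuousFunction_probabilityMeasure f))
    (fun ν hν => by
      have h := ha ν hν.2
      rw [← not_le, relEntropy_le_iff] at h
      push Not at h
      exact Set.mem_iUnion.2 h)
  refine ⟨t.card + 1, by positivity, fun N => ?_⟩
  set π := Measure.pi fun _ : Fin N => (μ : Measure S)
  calc π {y | empiricalMeasure y ∈ G}
      ≤ π ((⋃ f ∈ t, {y | empiricalMeasure y ∈ U f}) ∪
          {y | empiricalMeasure y ∉ logTightSet K (a + Real.log 2)}) := by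
        refine measure_mono fun y hy => ?_
        by_cases hT : empiricalMeasure y ∈ logTightSet K (a + Real.log 2)
        · have := ht ⟨hT, subset_closure hy⟩
          simp only [Set.mem_iUnion] at this
          exact .inl (by simpa using this)
        · exact .inr hT
    _ ≤ (∑ f ∈ t, π {y | empiricalMeasure y ∈ U f}) +
          π {y | empiricalMeasure y ∉ logTightSet K (a + Real.log 2)} :=
        (measure_union_le _ _).trans (add_le_add_left (measure_biUnion_finset_le _ _) _)
    _ ≤ (∑ f ∈ t, ENNReal.ofReal (Real.exp (-(N * a)))) + ENNReal.ofReal (Real.exp (-(N * a))) := by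
        refine add_le_add (Finset.sum_le_sum fun f _ => ?_)
          (pi_empiricalMeasure_notMem_logTightSet_le (fun n => (hK n).measurableSet) hμ a N)
        refine (measure_mono fun y hy => ?_).trans (pi_le_integral_empiricalMeasure_le _
          f.continuous.measurable f.norm_coe_le_norm a N)
        simp only [U, Set.mem_ofPred_eq] at hy ⊢
        exact hy.le
    _ = ENNReal.ofReal ((t.card + 1) * Real.exp (-(N * a))) := by
        rw [Finset.sum_const, nsmul_eq_mul, ENNReal.ofReal_mul (by positivity),
          ENNReal.ofReal_add (by positivity) zero_le_one]
        simp [add_mul]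

/-- The law of large numbers for empirical measures in the weak topology. The complements of
asymptotically negligible events form a filter, so convergence can be tested on integrals of single
bounded continuous functions. -/
theorem tendsto_pi_empiricalMeasure_notMem {S : Type*} [TopologicalSpace S] [MeasurableSpace S]
    [OpensMeasurableSpace S] (ν : ProbabilityMeasure S) {O : Set (ProbabilityMeasure S)}
    (hO : O ∈ 𝓝 ν) :
    Tendsto (fun N : ℕ+ => Measure.pi (fun _ : Fin N => (ν : Measure S))
      {y | empiricalMeasure y ∉ O}) atTop (𝓝 0) := by
  let F : Filter (ProbabilityMeasure S) :=
    { sets := {O | Tendsto (fun N : ℕ+ => Measure.pi (fun _ : Fin N => (ν : Measure S))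
        {y | empiricalMeasure y ∉ O}) atTop (𝓝 0)}
      univ_sets := by simp
      sets_of_superset := fun {A B} hA hAB => tendsto_of_tendsto_of_tendsto_of_le_of_le
        tendsto_const_nhds hA (fun _ => zero_le) fun N =>
          measure_mono fun y hy hyA => hy (hAB hyA)
      inter_sets := fun {A B} hA hB => by
        have h := Tendsto.add hA hB
        rw [add_zero] at h
        refine tendsto_of_tendsto_of_tendsto_of_le_of_le tendsto_const_nhds h
          (fun _ => zero_le) fun N => ?_
        refine (measure_mono fun y hy => ?_).trans (measure_union_le _ _)
        exact not_and_or.1 hy }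
  have hF : Tendsto id F (𝓝 ν) := by
    refine ProbabilityMeasure.tendsto_iff_forall_integral_tendsto.2 fun f => ?_
    refine Metric.tendsto_nhds.2 fun ε hε => ?_
    refine (tendsto_pi_le_abs_average_sub_integral (ν : Measure S) f.continuous.measurable
      (f.integrable _) hε).congr fun N => ?_
    congr 1
    ext y
    simp [Real.dist_eq, integral_empiricalMeasure y f.continuous.measurable]
  exact hF hO

/-- The lower bound in Sanov's theorem, by a change of measure: under the product of copies of `ν`
the empirical measure is close to `ν`, and the log-likelihood ratio is close to its mean, the
relative entropy, per coordinate. -/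
theorem eventually_le_pi_empiricalMeasure_mem {S : Type*} [TopologicalSpace S] [PolishSpace S]
    [MeasurableSpace S] [BorelSpace S] {μ ν : ProbabilityMeasure S}
    {O : Set (ProbabilityMeasure S)} (hO : O ∈ 𝓝 ν) (hfin : relEntropy ν μ ≠ ∞) {a : ℝ}
    (ha : (relEntropy ν μ).toReal < a) :
    ∀ᶠ N : ℕ+ in atTop, ENNReal.ofReal (1 / 2 * Real.exp (-(N * a))) ≤
      Measure.pi (fun _ : Fin N => (μ : Measure S)) {y | empiricalMeasure y ∈ O} := by
  obtain ⟨hac, hint⟩ := InformationTheory.klDiv_ne_top_iff.1 hfin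
  set R := (relEntropy ν μ).toReal
  have hR : R = ∫ s, llr (ν : Measure S) μ s ∂(ν : Measure S) :=
    InformationTheory.toReal_klDiv_of_measure_eq hac (by simp)
  -- a finite version of the density
  let r : S → ℝ := fun s => ((ν : Measure S).rnDeriv μ s).toReal
  have hr : Measurable r := (Measure.measurable_rnDeriv _ _).ennreal_toReal
  let h : S → ℝ≥0∞ := fun s => ENNReal.ofReal (r s)
  have hh : Measurable h := hr.ennreal_ofReal
  have hν : (μ : Measure S).withDensity h = ν := by
    conv_rhs => rw [← Measure.withDensity_rnDeriv_eq _ _ hac]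
    refine withDensity_congr_ae ?_
    filter_upwards [Measure.rnDeriv_lt_top (ν : Measure S) μ] with s hs
    exact ENNReal.ofReal_toReal hs.ne
  have : IsProbabilityMeasure ((μ : Measure S).withDensity h) := by rw [hν]; infer_instance
  have h1 := tendsto_pi_empiricalMeasure_notMem ν (interior_mem_nhds.2 hO)
  have h2 := tendsto_pi_le_abs_average_sub_integral (ν : Measure S) (measurable_llr _ _) hint
    (sub_pos.2 ha)
  have h12 := h1.add h2
  rw [add_zero] at h12
  filter_upwards [h12.eventually (gt_mem_nhds (ENNReal.inv_pos.2 (ENNReal.ofNat_ne_top (n := 2))))]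
    with N hN
  have hNpos : (0 : ℝ) < N := by exact_mod_cast N.pos
  let A : Set (Fin N → S) := {y | empiricalMeasure y ∈ interior O} ∩
    {y | ∑ i, Real.log (r (y i)) ≤ N * a}
  have hA : MeasurableSet A := by
    refine (isOpen_interior.preimage (continuous_empiricalMeasure N)).measurableSet.inter ?_
    exact measurableSet_le (by fun_prop) (by fun_prop)
  have hAc : Measure.pi (fun _ : Fin N => (ν : Measure S)) Aᶜ < 2⁻¹ := by
    refine lt_of_le_of_lt ((measure_mono fun y hy => ?_).trans (measure_union_le _ _)) hN
    rcases not_and_or.1 hy with hy | hy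
    · exact .inl hy
    · refine .inr (Set.mem_ofPred_eq ▸ le_trans ?_ (le_abs_self _))
      rw [← hR]
      simp only [Set.mem_ofPred_eq, not_le] at hy
      have : a ≤ (N : ℝ)⁻¹ * ∑ i, llr (ν : Measure S) μ (y i) := by
        rw [le_inv_mul_iff₀ hNpos]
        exact hy.le
      linarith
  have hA2 : 2⁻¹ ≤ Measure.pi (fun _ : Fin N => (ν : Measure S)) A := by
    by_contra! hlt
    have h3 := ENNReal.add_lt_add hlt hAc
    rw [measure_add_measure_compl hA, measure_univ, ENNReal.inv_two_add_inv_two] at h3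
    exact lt_irrefl _ h3
  have hA3 : Measure.pi (fun _ : Fin N => (ν : Measure S)) A ≤
      ENNReal.ofReal (Real.exp (N * a)) *
        Measure.pi (fun _ : Fin N => (μ : Measure S)) {y | empiricalMeasure y ∈ O} := by
    have e : Measure.pi (fun _ : Fin N => (ν : Measure S)) =
        (Measure.pi fun _ : Fin N => (μ : Measure S)).withDensity fun y => ∏ i, h (y i) := by
      rw [← pi_withDensity_eq _ hh, hν]
    rw [e, withDensity_apply _ hA]
    calc ∫⁻ y in A, ∏ i, h (y i) ∂Measure.pi (fun _ : Fin N => (μ : Measure S))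
        ≤ ∫⁻ y in A, ENNReal.ofReal (Real.exp (N * a))
            ∂Measure.pi (fun _ : Fin N => (μ : Measure S)) := by
          refine setLIntegral_mono measurable_const fun y hy => ?_
          calc ∏ i, h (y i) ≤ ∏ i, ENNReal.ofReal (Real.exp (Real.log (r (y i)))) :=
                Finset.prod_le_prod' fun i _ =>
                  ENNReal.ofReal_le_ofReal (Real.le_exp_log _)
            _ = ENNReal.ofReal (Real.exp (∑ i, Real.log (r (y i)))) := ofReal_exp_sum _
            _ ≤ _ := ENNReal.ofReal_le_ofReal (Real.exp_le_exp.2 hy.2)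
      _ = ENNReal.ofReal (Real.exp (N * a)) *
            Measure.pi (fun _ : Fin N => (μ : Measure S)) A := setLIntegral_const _ _
      _ ≤ _ := by
          gcongr
          exact fun y hy => interior_subset (s := O) hy.1
  have hpos : 0 < Real.exp (N * a) := Real.exp_pos _
  have h4 := hA2.trans hA3
  rw [Real.exp_neg, ← div_eq_mul_inv, ENNReal.ofReal_div_of_pos hpos]
  refine ENNReal.div_le_of_le_mul' (le_trans (le_of_eq ?_) h4)
  rw [one_div, ENNReal.ofReal_inv_of_pos (zero_lt_two (α := ℝ)), ENNReal.ofReal_ofNat]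

/-! ### Large deviation bounds on the logarithmic scale -/

theorem inv_mul_log_ofReal_mul_exp {C : ℝ} (hC : 0 < C) (a : ℝ) (N : ℕ+) :
    ((1 / (N : ℝ) : ℝ) : EReal) * ENNReal.log (ENNReal.ofReal (C * Real.exp (-(N * a)))) =
      ((Real.log C * (N : ℝ)⁻¹ - a : ℝ) : EReal) := by
  have hN : (N : ℝ) ≠ 0 := by exact_mod_cast N.ne_zero
  rw [ENNReal.log_ofReal_of_pos (by positivity), Real.log_mul hC.ne' (Real.exp_ne_zero _),
    Real.log_exp, ← EReal.coe_mul]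
  congr 1
  field_simp
  ring

theorem tendsto_log_mul_inv_sub (C a : ℝ) :
    Tendsto (fun N : ℕ+ => ((Real.log C * (N : ℝ)⁻¹ - a : ℝ) : EReal)) atTop
      (𝓝 ((-a : ℝ) : EReal)) := by
  refine (continuous_coe_real_ereal.tendsto _).comp ?_
  have h : Tendsto (fun N : ℕ+ => ((N : ℕ) : ℝ)⁻¹) atTop (𝓝 0) :=
    (tendsto_inv_atTop_zero.comp tendsto_natCast_atTop_atTop).comp tendsto_PNat_val_atTop_atTop
  simpa using (h.const_mul (Real.log C)).sub_const a

theorem inv_mul_log_le_inv_mul_log {p q : ℝ≥0∞} (h : p ≤ q) (N : ℕ+) :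
    ((1 / (N : ℝ) : ℝ) : EReal) * ENNReal.log p ≤ ((1 / (N : ℝ) : ℝ) : EReal) * ENNReal.log q :=
  mul_le_mul_of_nonneg_left (ENNReal.log_le_log h) (by exact_mod_cast by positivity)

theorem limsup_inv_mul_log_le {p : ℕ+ → ℝ≥0∞} {c : EReal}
    (h : ∀ a : ℝ, (a : EReal) < c →
      ∃ C : ℝ, 0 < C ∧ ∀ N, p N ≤ ENNReal.ofReal (C * Real.exp (-(N * a)))) :
    limsup (fun N : ℕ+ => ((1 / (N : ℝ) : ℝ) : EReal) * ENNReal.log (p N)) atTop ≤ -c := by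
  by_contra! hlt
  obtain ⟨b, hb1, hb2⟩ := EReal.lt_iff_exists_real_btwn.1 hlt
  obtain ⟨C, hC, hp⟩ := h (-b) (by rw [EReal.coe_neg]; exact EReal.neg_lt_comm.1 hb1)
  refine absurd hb2 (not_lt.2 ?_)
  calc _ ≤ limsup (fun N : ℕ+ => ((Real.log C * (N : ℝ)⁻¹ - -b : ℝ) : EReal)) atTop :=
        limsup_le_limsup (.of_forall fun N => (inv_mul_log_le_inv_mul_log (hp N) N).trans_eq
          (inv_mul_log_ofReal_mul_exp hC _ N))
    _ = b := by rw [(tendsto_log_mul_inv_sub C (-b)).limsup_eq, neg_neg]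

theorem le_liminf_inv_mul_log {p : ℕ+ → ℝ≥0∞} {c : EReal}
    (h : ∀ a : ℝ, c < a →
      ∃ C : ℝ, 0 < C ∧ ∀ᶠ N : ℕ+ in atTop, ENNReal.ofReal (C * Real.exp (-(N * a))) ≤ p N) :
    -c ≤ liminf (fun N : ℕ+ => ((1 / (N : ℝ) : ℝ) : EReal) * ENNReal.log (p N)) atTop := by
  by_contra! hlt
  obtain ⟨b, hb1, hb2⟩ := EReal.lt_iff_exists_real_btwn.1 hlt
  obtain ⟨C, hC, hp⟩ := h (-b) (by rw [EReal.coe_neg]; exact EReal.lt_neg_comm.1 hb2)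
  refine absurd hb1 (not_lt.2 ?_)
  calc (b : EReal) = liminf (fun N : ℕ+ => ((Real.log C * (N : ℝ)⁻¹ - -b : ℝ) : EReal)) atTop := by
        rw [(tendsto_log_mul_inv_sub C (-b)).liminf_eq, neg_neg]
    _ ≤ _ := liminf_le_liminf (hp.mono fun N hN =>
        (inv_mul_log_ofReal_mul_exp hC _ N).symm.trans_le (inv_mul_log_le_inv_mul_log hN N))

/-! ### Push-forward and measurability of empirical measures -/

theorem map_empiricalMeasure {S T : Type*} [MeasurableSpace S] [MeasurableSpace T] {N : ℕ+}
    (x : Fin N → S) {f : S → T} (hf : Measurable f) :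
    (empiricalMeasure x).map hf.aemeasurable = empiricalMeasure fun i => f (x i) := by
  apply Subtype.ext
  change Measure.map f (empiricalMeasure x : Measure S) = (empiricalMeasure fun i => f (x i) :)
  rw [coe_empiricalMeasure, coe_empiricalMeasure, Measure.map_smul,
    ← Measure.mapₗ_apply_of_measurable hf, map_sum]
  simp_rw [Measure.mapₗ_apply_of_measurable hf, Measure.map_dirac' hf]

theorem measurable_empiricalMeasure {S Ω : Type*} [TopologicalSpace S]
    [SecondCountableTopology S] [MeasurableSpace S] [BorelSpace S] [MeasurableSpace Ω] {N : ℕ+}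
    {X : Fin N → Ω → S} (hX : ∀ i, Measurable (X i)) :
    Measurable[_, borel (ProbabilityMeasure S)] fun ω => empiricalMeasure fun i => X i ω := by
  have h := (continuous_empiricalMeasure (S := S) N).borel_measurable
  rw [← BorelSpace.measurable_eq (α := Fin N → S)] at h
  exact @Measurable.comp _ _ _ _ _ (borel _) _ _ h (measurable_pi_lambda _ hX)

/-! ### Contraction along the fixed-point map -/

theorem noiseRate_le_relEntropy {𝒳 𝒴 : Type*} [MeasurableSpace 𝒳] [MeasurableSpace 𝒴]
    (γ₀ : ProbabilityMeasure 𝒴) (D : Set (ProbabilityMeasure 𝒴)) (μstar : D → ProbabilityMeasure 𝒳)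
    (γ : D) : noiseRate γ₀ D μstar (μstar γ) ≤ relEntropy (γ : ProbabilityMeasure 𝒴) γ₀ :=
  iInf₂_le (f := fun (γ' : D) (_ : μstar γ' = μstar γ) =>
    relEntropy (γ' : ProbabilityMeasure 𝒴) γ₀) γ rfl

/-- The sublevel set at `c` is the intersection of the images, under the contracting map, of the
compact entropy sublevel sets at `c + ε`; the map is continuous on each of these. -/
theorem isGoodRateFunction_noiseRate {𝒳 𝒴 : Type*}
    [TopologicalSpace 𝒳] [PolishSpace 𝒳] [MeasurableSpace 𝒳] [BorelSpace 𝒳]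
    [TopologicalSpace 𝒴] [PolishSpace 𝒴] [MeasurableSpace 𝒴] [BorelSpace 𝒴]
    (γ₀ : ProbabilityMeasure 𝒴) (D : Set (ProbabilityMeasure 𝒴)) (μstar : D → ProbabilityMeasure 𝒳)
    (hcont : ∀ γ : ProbabilityMeasure 𝒴, relEntropy γ γ₀ < ∞ →
      ∃ hγ : γ ∈ D, ContinuousAt μstar ⟨γ, hγ⟩) :
    IsGoodRateFunction (noiseRate γ₀ D μstar) := by
  let _ := TopologicalSpace.upgradeIsCompletelyMetrizable 𝒳
  have himage : ∀ c : ℝ≥0, IsCompact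
      (μstar '' {γ : D | relEntropy (γ : ProbabilityMeasure 𝒴) γ₀ ≤ c}) := fun c => by
    refine IsCompact.image_of_continuousOn ?_ fun γ hγ => ?_
    · rw [Subtype.isCompact_iff]
      convert! isCompact_relEntropy_le γ₀ c using 1
      ext γ
      refine ⟨?_, fun h => ?_⟩
      · rintro ⟨γ, hγ, rfl⟩
        exact hγ
      · obtain ⟨hγ, -⟩ := hcont γ (lt_of_le_of_lt h ENNReal.coe_lt_top)
        exact ⟨⟨γ, hγ⟩, h, rfl⟩
    · obtain ⟨_, h⟩ := hcont γ (lt_of_le_of_lt hγ ENNReal.coe_lt_top)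
      exact h.continuousWithinAt
  have hsub : ∀ c : ℝ≥0, {η | noiseRate γ₀ D μstar η ≤ c} = ⋂ ε : Set.Ioi (0 : ℝ≥0),
      μstar '' {γ : D | relEntropy (γ : ProbabilityMeasure 𝒴) γ₀ ≤ (c + ε : ℝ≥0)} := fun c => by
    ext η
    simp only [Set.mem_iInter, Set.mem_ofPred_eq]
    refine ⟨fun h ε => ?_, fun h => ?_⟩
    · have hlt : noiseRate γ₀ D μstar η < (c + ε : ℝ≥0) :=
        h.trans_lt (by exact_mod_cast lt_add_of_pos_right c ε.2)
      simp only [noiseRate, iInf_lt_iff] at hlt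
      obtain ⟨γ, hγ, hlt⟩ := hlt
      exact ⟨γ, hlt.le, hγ⟩
    · refine ENNReal.le_of_forall_pos_le_add fun ε hε _ => ?_
      obtain ⟨γ, hγ, rfl⟩ := h ⟨ε, hε⟩
      exact (noiseRate_le_relEntropy γ₀ D μstar γ).trans (by
        rwa [Set.mem_ofPred_eq, ENNReal.coe_add] at hγ)
  have hcomp : ∀ c : ℝ≥0, IsCompact {η | noiseRate γ₀ D μstar η ≤ c} := fun c => by
    rw [hsub]
    refine (himage (c + 1)).of_isClosed_subset (isClosed_iInter fun ε => (himage _).isClosed) ?_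
    exact Set.iInter_subset _ (⟨1, Set.mem_Ioi.2 zero_lt_one⟩ : Set.Ioi (0 : ℝ≥0))
  refine ⟨lowerSemicontinuous_iff_isClosed_preimage.2 fun c => ?_, hcomp⟩
  induction c with
  | top => simp
  | coe c => exact (hcomp c).isClosed

/-- The contraction principle applied to Sanov's theorem. The contracting map need only be
continuous at the measures of finite relative entropy, since no others contribute to the exponential rates. -/
theorem satisfiesLDP_of_ae_eq_contraction {𝒳 𝒴 : Type*}
    [TopologicalSpace 𝒳] [PolishSpace 𝒳] [MeasurableSpace 𝒳] [BorelSpace 𝒳]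
    [TopologicalSpace 𝒴] [PolishSpace 𝒴] [MeasurableSpace 𝒴] [BorelSpace 𝒴]
    {Ω : ℕ+ → Type*} [∀ N, MeasurableSpace (Ω N)]
    (P : ∀ N, Measure (Ω N)) [∀ N, IsProbabilityMeasure (P N)]
    {ξ : ∀ N, Ω N → ProbabilityMeasure 𝒳}
    (hξ : ∀ N, Measurable[_, borel (ProbabilityMeasure 𝒳)] (ξ N))
    (γ₀ : ProbabilityMeasure 𝒴) (Y : ∀ N : ℕ+, Fin N → Ω N → 𝒴) (hY : ∀ N i, Measurable (Y N i))
    (hlaw : ∀ N, (P N).map (fun ω i => Y N i ω) = Measure.pi fun _ : Fin N => (γ₀ : Measure 𝒴))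
    (D : Set (ProbabilityMeasure 𝒴)) (μstar : D → ProbabilityMeasure 𝒳)
    (hcont : ∀ γ : ProbabilityMeasure 𝒴, relEntropy γ γ₀ < ∞ →
      ∃ hγ : γ ∈ D, ContinuousAt μstar ⟨γ, hγ⟩)
    (hae : ∀ N, ∀ᵐ ω ∂P N, ∃ h : (empiricalMeasure fun i => Y N i ω) ∈ D,
      ξ N ω = μstar ⟨_, h⟩) :
    SatisfiesLDP P ξ (noiseRate γ₀ D μstar) := by
  have hYm : ∀ N, Measurable fun ω i => Y N i ω := fun N => measurable_pi_lambda _ (hY N)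
  refine ⟨hξ, fun B _ => le_liminf_inv_mul_log fun a ha => ?_,
    fun B _ => limsup_inv_mul_log_le fun a ha => ?_⟩
  · simp only [iInf_lt_iff] at ha
    obtain ⟨η, hη, ha⟩ := ha
    have ha0 : 0 ≤ a := by
      exact_mod_cast (EReal.coe_ennreal_nonneg (noiseRate γ₀ D μstar η)).trans ha.le
    have haE : (a : EReal) = (ENNReal.ofReal a : EReal) := by
      rw [EReal.coe_ennreal_ofReal, max_eq_left ha0]
    rw [haE, EReal.coe_ennreal_lt_coe_ennreal_iff] at ha
    simp only [noiseRate, iInf_lt_iff] at ha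
    obtain ⟨γ, rfl, ha⟩ := ha
    have hfin : relEntropy (γ : ProbabilityMeasure 𝒴) γ₀ ≠ ∞ := (ha.trans ENNReal.ofReal_lt_top).ne
    obtain ⟨_, hγc⟩ := hcont γ hfin.lt_top
    obtain ⟨u, hu, huB⟩ := (mem_nhds_subtype D γ _).1
      (hγc.preimage_mem_nhds (isOpen_interior.mem_nhds hη))
    refine ⟨1 / 2, by norm_num, ?_⟩
    filter_upwards [eventually_le_pi_empiricalMeasure_mem (interior_mem_nhds.2 hu) hfin
      ((ENNReal.lt_ofReal_iff_toReal_lt hfin).1 ha)] with N hN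
    refine hN.trans ?_
    have hmeas : MeasurableSet {y : Fin N → 𝒴 | empiricalMeasure y ∈ interior u} :=
      (isOpen_interior.preimage (continuous_empiricalMeasure N)).measurableSet
    rw [← hlaw N, Measure.map_apply (hYm N) hmeas]
    refine measure_mono_ae ?_
    filter_upwards [hae N] with ω ⟨hD, hω⟩ hmem
    change ξ N ω ∈ B
    rw [hω]
    exact interior_subset (huB (show _ ∈ u from interior_subset hmem))
  · rcases lt_or_ge a 0 with ha0 | ha0
    · refine ⟨1, one_pos, fun N => prob_le_one.trans ?_⟩
      rw [one_mul, ENNReal.one_le_ofReal]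
      have : (N : ℝ) * a ≤ 0 := mul_nonpos_of_nonneg_of_nonpos (Nat.cast_nonneg _) ha0.le
      exact Real.one_le_exp (by linarith)
    lift a to ℝ≥0 using ha0
    let G : Set (ProbabilityMeasure 𝒴) := (↑) '' (μstar ⁻¹' closure B)
    have hG : ∀ ν ∈ closure G, a < relEntropy ν γ₀ := fun ν hν => by
      rcases eq_or_ne (relEntropy ν γ₀) ∞ with htop | hfin
      · rw [htop]; exact ENNReal.coe_lt_top
      obtain ⟨hD, hc⟩ := hcont ν hfin.lt_top
      have h1 : (⟨ν, hD⟩ : D) ∈ closure (μstar ⁻¹' closure B) := closure_subtype.2 hν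
      have h2 : μstar ⟨ν, hD⟩ ∈ closure B :=
        closure_minimal (Set.image_preimage_subset _ _) isClosed_closure
          (mem_closure_image hc h1)
      have h3 : noiseRate γ₀ D μstar (μstar ⟨ν, hD⟩) ≤ relEntropy ν γ₀ :=
        noiseRate_le_relEntropy γ₀ D μstar ⟨ν, hD⟩
      have h4 := ha.trans_le ((iInf₂_le (μstar ⟨ν, hD⟩) h2).trans
        (EReal.coe_ennreal_le_coe_ennreal_iff.2 h3))
      have haE : ((a : ℝ) : EReal) = ((a : ℝ≥0∞) : EReal) := rfl
      rwa [haE, EReal.coe_ennreal_lt_coe_ennreal_iff] at h4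
    obtain ⟨C, hC, hle⟩ := exists_pi_empiricalMeasure_mem_le γ₀ hG
    refine ⟨C, hC, fun N => le_trans ?_ (hle N)⟩
    rw [← hlaw N]
    refine le_trans (measure_mono_ae ?_) (Measure.le_map_apply (hYm N).aemeasurable _)
    filter_upwards [hae N] with ω ⟨hD, hω⟩ hmem
    change ξ N ω ∈ B at hmem
    rw [hω] at hmem
    exact ⟨_, subset_closure hmem, rfl⟩

theorem theorem4p1 {𝒳 𝒴 : Type*}
    [TopologicalSpace 𝒳] [PolishSpace 𝒳] [MeasurableSpace 𝒳] [BorelSpace 𝒳]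
    [TopologicalSpace 𝒴] [PolishSpace 𝒴] [MeasurableSpace 𝒴] [BorelSpace 𝒴]
    {Ω : ℕ+ → Type*} [∀ N, MeasurableSpace (Ω N)]
    (P : ∀ N, Measure (Ω N)) [∀ N, IsProbabilityMeasure (P N)]
    (X : ∀ N : ℕ+, Fin N → Ω N → 𝒳) (hX : ∀ N i, Measurable (X N i))
    -- the noise-based representation
    (γ₀ : ProbabilityMeasure 𝒴)
    (ψ : ProbabilityMeasure 𝒳 × 𝒴 → 𝒳) (hψ : Measurable[borel (ProbabilityMeasure 𝒳 × 𝒴)] ψ)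
    (Y : ∀ N : ℕ+, Fin N → Ω N → 𝒴) (hY : ∀ N i, Measurable (Y N i))
    (hYindep : ∀ N, iIndepFun (Y N) (P N))
    (hYlaw : ∀ N i, (P N).map (Y N i) = (γ₀ : Measure 𝒴))
    (hrep : ∀ N i, ∀ᵐ ω ∂(P N), X N i ω = ψ (empiricalMeasure (fun j => X N j ω), Y N i ω))
    (D : Set (ProbabilityMeasure 𝒴)) (hD : MeasurableSet[borel (ProbabilityMeasure 𝒴)] D)
    -- unique fixed points on `D`, depending measurably on `γ ∈ D`
    (μstar : D → ProbabilityMeasure 𝒳)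
    (hfix : ∀ γ : D, noiseMap ψ hψ γ (μstar γ) = μstar γ)
    (huniq : ∀ (γ : D) (μ : ProbabilityMeasure 𝒳), noiseMap ψ hψ γ μ = μ → μ = μstar γ)
    (hmeas : Measurable[borel D, borel (ProbabilityMeasure 𝒳)] μstar)
    -- empirical measures of `γ₀`-samples lie in `D` almost surely
    (hDfull : ∀ N : ℕ+, Measure.pi (fun _ : Fin N => (γ₀ : Measure 𝒴))
      {y | empiricalMeasure y ∈ D} = 1)
    -- finite relative entropy implies membership in `D` and continuity of `μ_*`
    (hcont : ∀ γ : ProbabilityMeasure 𝒴, relEntropy γ γ₀ < ∞ →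
      ∃ hγ : γ ∈ D, ContinuousAt μstar ⟨γ, hγ⟩) :
    IsGoodRateFunction (noiseRate γ₀ D μstar) ∧
      SatisfiesLDP P (fun N ω => empiricalMeasure (fun i => X N i ω)) (noiseRate γ₀ D μstar) := by
  have hlaw : ∀ N, (P N).map (fun ω i => Y N i ω) =
      Measure.pi fun _ : Fin N => (γ₀ : Measure 𝒴) := fun N => by
    rw [(hYindep N).map_fun_eq_pi_map fun i => (hY N i).aemeasurable]
    simp_rw [hYlaw]
  refine ⟨isGoodRateFunction_noiseRate γ₀ D μstar hcont, satisfiesLDP_of_ae_eq_contraction P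
    (fun N => measurable_empiricalMeasure (hX N)) γ₀ Y hY hlaw D μstar hcont fun N => ?_⟩
  have hDm : MeasurableSet {y : Fin N → 𝒴 | empiricalMeasure y ∈ D} :=
    measurable_empiricalMeasure (fun i => measurable_pi_apply i) hD
  have hDae : ∀ᵐ ω ∂P N, (empiricalMeasure fun i => Y N i ω) ∈ D := by
    have h : ∀ᵐ y ∂(P N).map (fun ω i => Y N i ω), empiricalMeasure y ∈ D := by
      rw [hlaw N]
      exact (mem_ae_iff_prob_eq_one hDm).2 (hDfull N)
    exact ae_of_ae_map (measurable_pi_lambda _ (hY N)).aemeasurable h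
  filter_upwards [hDae, ae_all_iff.2 (hrep N)] with ω hω hrepω
  refine ⟨hω, huniq ⟨_, hω⟩ _ ?_⟩
  -- the empirical measure of the particles is a fixed point for that of the noise
  set μ := empiricalMeasure fun i => X N i ω with hμ
  calc noiseMap ψ hψ (empiricalMeasure fun i => Y N i ω) μ
      = empiricalMeasure fun i => ψ (μ, Y N i ω) :=
        map_empiricalMeasure _ (measurable_section_of_borel hψ μ)
    _ = μ := by rw [hμ]; exact congrArg empiricalMeasure (funext fun i => (hrepω i).symm)
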